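/- Let $H$ be a complex Hilbert space and let $A$ be a $C^*$-algebra with $\mathbb K(H)\subseteq A\subseteq \mathbb B(H)$, that is, a norm-closed $*$-subalgebra of the algebra $\mathbb B(H)$ of bounded operators that contains all compact operators. An inner product $A$-module is a complex vector space $E$ with a compatible right $A$-module structure and a map $\langle\cdot,\cdot\rangle:E\times E\to A$ that is $\mathbb C$-linear in the second variable and satisfies $\langle x,ya\rangle=\langle x,y\rangle a$, $\langle x,y\rangle^*=\langle y,x\rangle$, $\langle x,x\rangle\ge 0$, and $\langle x,x\rangle=0$ if and only if $x=0$ (completeness is not required); write $|x|=\langle x,x\rangle^{1/2}\in A$. Let $E$ and $F$ be inner product $A$-modules and let $T:E\to F$ be a nonzero $\mathbb C$-linear map that is local ($xa=0\Rightarrow (Tx)a=0$ for all $x\in E$, $a\in A$) and orthogonality preserving ($\langle x,y\rangle=0\Rightarrow\langle Tx,Ty\rangle=0$ for all $x,y\in E$). Then there is a real number $\gamma>0$ such that $\langle Tx,Ty\rangle=\gamma\langle x,y\rangle$ for all $x,y\in E$. Moreover, for all $x,y\in E$: (i) $|x|=|y|$ if and only if $|Tx|=|Ty|$; (ii) $|x|\le|y|$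 if and only if $|Tx|\le|Ty|$. -/

import Mathlib

open scoped RightActions

/-- An inner product module over a C⋆-algebra `A`, with `A` acting on the right: `x <• a` is the
right action of `a : A` on `x : E`. The `A`-valued inner product is linear in the second variable
and right `A`-linear there, and no completeness is required. (The class `CStarModule` of Mathlib
describes modules with a left action and carries a norm as extra data.) -/
class InnerProductCModule (A E : Type*) [NonUnitalCStarAlgebra A] [PartialOrder A]
    [AddCommGroup E] [Module ℂ E] [SMul Aᵐᵒᵖ E] extends Inner A E where
  add_act (x y : E) (a : A) : (x + y) <• a = x <• a + y <• a
  act_add (x : E) (a b : A) : x <• (a + b) = x <• a + x <• b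
  act_mul (x : E) (a b : A) : x <• (a * b) = (x <• a) <• b
  smul_act (c : ℂ) (x : E) (a : A) : (c • x) <• a = c • (x <• a)
  act_smul (c : ℂ) (x : E) (a : A) : x <• (c • a) = c • (x <• a)
  inner_add_right (x y z : E) : inner x (y + z) = inner x y + inner x z
  inner_smul_right (c : ℂ) (x y : E) : inner x (c • y) = c • inner x y
  inner_act_right (x y : E) (a : A) : inner x (y <• a) = inner x y * a
  star_inner (x y : E) : star (inner x y) = inner y x
  inner_self_nonneg (x : E) : 0 ≤ inner x x
  inner_self_eq_zero (x : E) : inner x x = 0 ↔ x = 0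

/-- The `A`-valued modulus `|x|`: the positive square root of `⟨x, x⟩` in `A`. -/
noncomputable def InnerProductCModule.modulus (A : Type*) {E : Type*} [NonUnitalCStarAlgebra A]
    [PartialOrder A] [StarOrderedRing A] [AddCommGroup E] [Module ℂ E] [SMul Aᵐᵒᵖ E]
    [InnerProductCModule A E] (x : E) : A :=
  CFC.sqrt (inner A x x)

/-- A linear map is local if `x a = 0` implies `(T x) a = 0`. -/
def IsLocalMap (A : Type*) {E F : Type*} [AddCommGroup E] [Module ℂ E] [SMul Aᵐᵒᵖ E]
    [AddCommGroup F] [Module ℂ F] [SMul Aᵐᵒᵖ F] (T : E →ₗ[ℂ] F) : Prop :=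
  ∀ (x : E) (a : A), x <• a = 0 → T x <• a = 0

/-- A linear map preserves orthogonality if `⟨x, y⟩ = 0` implies `⟨T x, T y⟩ = 0`. -/
def IsOrthogonalityPreserving (A : Type*) {E F : Type*} [Zero A] [AddCommGroup E] [Module ℂ E]
    [Inner A E] [AddCommGroup F] [Module ℂ F] [Inner A F] (T : E →ₗ[ℂ] F) : Prop :=
  ∀ x y : E, inner A x y = 0 → inner A (T x) (T y) = 0

/-- In a closed `*`-subalgebra `A` of `𝔹(H)` (with the order inherited from `𝔹(H)`), an element is
positive if and only if it has the form `b⋆ b` with `b ∈ A`. -/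
theorem NonUnitalStarSubalgebra.nonneg_iff_exists_star_mul_self {H : Type*}
    [NormedAddCommGroup H] [InnerProductSpace ℂ H] [CompleteSpace H]
    (A : NonUnitalStarSubalgebra ℂ (H →L[ℂ] H)) [IsClosed (A : Set (H →L[ℂ] H))] (a : A) :
    0 ≤ a ↔ ∃ b : A, a = star b * b := by
  constructor
  · intro h
    have h0 : (0 : H →L[ℂ] H) ≤ (a : H →L[ℂ] H) := h
    have hsa : IsSelfAdjoint a := Subtype.ext (IsSelfAdjoint.of_nonneg h0)
    refine ⟨cfcₙ Real.sqrt a, ?_⟩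
    have hs : IsSelfAdjoint (cfcₙ Real.sqrt a) := cfcₙ_predicate _ a
    rw [hs.star_eq]
    apply Subtype.ext
    have hm : ((cfcₙ Real.sqrt a : A) : H →L[ℂ] H) = cfcₙ Real.sqrt (a : H →L[ℂ] H) :=
      NonUnitalStarAlgHomClass.map_cfcₙ (R := ℝ) (S := ℂ)
        (NonUnitalStarSubalgebraClass.subtype A) Real.sqrt a
        (hφ := continuous_subtype_val) (ha := hsa) (hφa := IsSelfAdjoint.of_nonneg h0)
    change (a : H →L[ℂ] H) = ((cfcₙ Real.sqrt a : A) : H →L[ℂ] H) * ((cfcₙ Real.sqrt a : A) : H →L[ℂ] H)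
    rw [hm, ← cfcₙ_mul Real.sqrt Real.sqrt (a : H →L[ℂ] H)]
    conv_lhs => rw [← cfcₙ_id' ℝ (a : H →L[ℂ] H) (IsSelfAdjoint.of_nonneg h0)]
    refine cfcₙ_congr fun t ht => ?_
    exact (Real.mul_self_sqrt (quasispectrum_nonneg_of_nonneg _ h0 t ht)).symm
  · rintro ⟨b, rfl⟩
    exact star_mul_self_nonneg (b : H →L[ℂ] H)

instance NonUnitalStarSubalgebra.starOrderedRingOfClosed {H : Type*}
    [NormedAddCommGroup H] [InnerProductSpace ℂ H] [CompleteSpace H]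
    (A : NonUnitalStarSubalgebra ℂ (H →L[ℂ] H)) [IsClosed (A : Set (H →L[ℂ] H))] :
    StarOrderedRing A :=
  StarOrderedRing.of_nonneg_iff'
    (fun {_ _} hxy z => add_le_add_right (α := H →L[ℂ] H) (a := z) hxy)
    (fun a => A.nonneg_iff_exists_star_mul_self a)

open scoped ComplexOrder

/-! Fix a unit vector ζ and the minimal projection e = ζ ⊗ ζ. Since eAe = ℂe, the inner product on
Ee is a scalar form times e, so orthogonality in Ee is that of a complex pre-Hilbert space, and
`exists_nonneg_eq_mul_of_orthogonality` yields γ there. Locality makes T commute with rank one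
operators (`IsLocalMap.map_act_rankOneMem`). Each coefficient ⟪ξ, ⟨x, y⟩ η⟫ is the scalar form at
x(ξ ⊗ ζ) and y(η ⊗ ζ), both in Ee, so the same γ works on all of E. Then |Tx| = √γ |x|. -/

/-- A Hermitian form that vanishes wherever a definite positive one does is a nonnegative multiple
of it. -/
theorem exists_nonneg_eq_mul_of_orthogonality {V : Type*} [AddCommGroup V] [Module ℂ V]
    (B C : V → V →ₗ[ℂ] ℂ) (hB : ∀ x y, star (B x y) = B y x) (hC : ∀ x y, star (C x y) = C y x)
    (hB0 : ∀ x, 0 ≤ B x x) (hC0 : ∀ x, 0 ≤ C x x) (hdef : ∀ x, B x x = 0 → x = 0)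
    (h : ∀ x y, B x y = 0 → C x y = 0) :
    ∃ γ : ℝ, 0 ≤ γ ∧ ∀ x y, C x y = γ * B x y := by
  have hreal : ∀ x, ∃ γ : ℝ, 0 ≤ γ ∧ ∀ y, C x y = γ * B x y := by
    intro x
    obtain ⟨b, hb0, hb⟩ := (RCLike.nonneg_iff_exists_ofReal (K := ℂ)).1 (hB0 x)
    obtain ⟨c, hc0, hc⟩ := (RCLike.nonneg_iff_exists_ofReal (K := ℂ)).1 (hC0 x)
    rcases eq_or_ne (B x x) 0 with h0 | h0
    · refine ⟨0, le_rfl, fun y => ?_⟩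
      have hx := hdef x h0
      have h1 : B y x = 0 := by rw [hx, map_zero]
      have h2 : B x y = 0 := by rw [← hB, h1, star_zero]
      simp [h x y h2]
    · refine ⟨c / b, by positivity, fun y => ?_⟩
      -- Subtracting the B-projection onto x leaves a vector B-orthogonal, hence C-orthogonal, to x.
      have h1 : B x (y - (B x y / B x x) • x) = 0 := by
        rw [map_sub, map_smul, smul_eq_mul, div_mul_cancel₀ _ h0, sub_self]
      have h2 := h _ _ h1
      rw [map_sub, map_smul, smul_eq_mul, sub_eq_zero] at h2
      rw [h2, ← hb, ← hc]
      simp only [Complex.coe_algebraMap, Complex.ofReal_div]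
      ring
  choose g hg0 hg using hreal
  have hsymm : ∀ x y, B x y ≠ 0 → g x = g y := by
    intro x y hxy
    have h1 : C x y = g y * B x y := by
      rw [← hC, hg, ← hB x y]
      simp
    rw [hg x y] at h1
    exact_mod_cast mul_right_cancel₀ hxy h1
  by_cases hV : ∃ x : V, x ≠ 0
  · obtain ⟨x, hx⟩ := hV
    have hxx : B x x ≠ 0 := fun h0 => hx (hdef x h0)
    have key : ∀ y, y ≠ 0 → g y = g x := by
      intro y hy
      have hyy : B y y ≠ 0 := fun h0 => hy (hdef y h0)
      by_cases hxy : B x y = 0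
      · have hyx : B y x = 0 := by rw [← hB, hxy, star_zero]
        -- When x and y are orthogonal, x + y is orthogonal to neither and links their constants.
        rw [hsymm y (x + y) (by rwa [map_add, hyx, zero_add]),
          hsymm x (x + y) (by rwa [map_add, hxy, add_zero])]
      · exact (hsymm x y hxy).symm
    refine ⟨g x, hg0 x, fun y z => ?_⟩
    rcases eq_or_ne y 0 with rfl | hy
    · have h2 : B 0 z = 0 := by rw [← hB, map_zero, star_zero]
      rw [h2, h _ _ h2, mul_zero]
    · rw [hg, key y hy]
  · push Not at hV
    refine ⟨0, le_rfl, fun x y => ?_⟩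
    rw [hV y, map_zero, map_zero, mul_zero]

/-! ### Inner product modules and the modulus -/

namespace InnerProductCModule

section Basic

variable {A E : Type*} [NonUnitalCStarAlgebra A] [PartialOrder A]
  [AddCommGroup E] [Module ℂ E] [SMul Aᵐᵒᵖ E] [InnerProductCModule A E]

/-- The right action of a fixed algebra element as a linear map. -/
def actRight (E : Type*) [AddCommGroup E] [Module ℂ E] [SMul Aᵐᵒᵖ E] [InnerProductCModule A E]
    (a : A) : E →ₗ[ℂ] E where
  toFun x := x <• a
  map_add' x y := add_act x y a
  map_smul' c x := smul_act c x a

/-- The right action on a fixed vector as a linear map. -/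
def actOn (A : Type*) [NonUnitalCStarAlgebra A] [PartialOrder A] [SMul Aᵐᵒᵖ E]
    [InnerProductCModule A E] (x : E) : A →ₗ[ℂ] E where
  toFun a := x <• a
  map_add' a b := act_add x a b
  map_smul' c a := act_smul c x a

/-- The inner product with a fixed first argument as a linear map. -/
def innerLeft (A : Type*) [NonUnitalCStarAlgebra A] [PartialOrder A] [SMul Aᵐᵒᵖ E]
    [InnerProductCModule A E] (x : E) : E →ₗ[ℂ] A where
  toFun y := inner A x y
  map_add' y z := inner_add_right x y z
  map_smul' c y := inner_smul_right c x y

theorem sub_act (x y : E) (a : A) : (x - y) <• a = x <• a - y <• a :=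
  map_sub (actRight E a) x y

theorem act_sub (x : E) (a b : A) : x <• (a - b) = x <• a - x <• b :=
  map_sub (actOn A x) a b

theorem inner_act_left (x y : E) (a : A) : inner A (x <• a) y = star a * inner A x y := by
  rw [← star_inner, inner_act_right, star_mul, star_inner]

/-- `A` may lack a unit, so a = ⟨x, x⟩ serves as the test element: ⟨x, x⟩² = ⟨x, xa⟩ = 0. -/
theorem eq_zero_of_forall_act_eq_zero {x : E} (h : ∀ a : A, x <• a = 0) : x = 0 := by
  rw [← inner_self_eq_zero (A := A)]
  have h1 : star (inner A x x) * inner A x x = 0 := by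
    rw [star_inner, ← inner_act_right, h]
    exact map_zero (innerLeft A x)
  exact CStarRing.star_mul_self_eq_zero_iff _ |>.1 h1

end Basic

section Modulus

variable {A E F : Type*} [NonUnitalCStarAlgebra A] [PartialOrder A] [StarOrderedRing A]
  [AddCommGroup E] [Module ℂ E] [SMul Aᵐᵒᵖ E] [InnerProductCModule A E]
  [AddCommGroup F] [Module ℂ F] [SMul Aᵐᵒᵖ F] [InnerProductCModule A F]

theorem modulus_eq_smul_of_inner_self {x : E} {y : F} {γ : ℝ} (hγ : 0 ≤ γ)
    (h : inner A y y = γ • inner A x x) : modulus A y = √γ • modulus A x := by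
  unfold modulus
  have h0 : (0 : A) ≤ inner A x x := inner_self_nonneg x
  refine CFC.sqrt_unique ?_ (smul_nonneg (Real.sqrt_nonneg γ) (CFC.sqrt_nonneg _))
  rw [smul_mul_smul_comm, Real.mul_self_sqrt hγ, CFC.sqrt_mul_sqrt_self _ h0, h]

end Modulus

end InnerProductCModule

/-! ### Local maps and multiples of idempotents -/

section Local

open InnerProductCModule

variable {A E F : Type*} [NonUnitalCStarAlgebra A] [PartialOrder A]
  [AddCommGroup E] [Module ℂ E] [SMul Aᵐᵒᵖ E] [InnerProductCModule A E]
  [AddCommGroup F] [Module ℂ F] [SMul Aᵐᵒᵖ F] [InnerProductCModule A F]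

/-- A local map commutes with the action of nonzero multiples of idempotents. -/
theorem IsLocalMap.map_act_of_mul_self {T : E →ₗ[ℂ] F} (hT : IsLocalMap A T) {p : A} {c : ℂ}
    (hc : c ≠ 0) (hp : p * p = c • p) (x : E) : T (x <• p) = T x <• p := by
  have h1 : c • (T x <• p) = T (x <• p) <• p := by
    have := hT (c • x - x <• p) p (by
      rw [sub_act, smul_act, ← act_mul, hp, act_smul, sub_self])
    rwa [map_sub, map_smul, sub_act, smul_act, sub_eq_zero] at this
  have h2 : c • T (x <• p) = T (x <• p) <• p := by
    rw [← sub_eq_zero]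
    refine eq_zero_of_forall_act_eq_zero (A := A) fun a => ?_
    -- Stands in for (c - p)a, as c itself need not lie in `A`.
    have := hT (x <• p) (c • a - p * a) (by
      rw [← act_mul, mul_sub, ← mul_assoc, hp, mul_smul_comm, smul_mul_assoc, sub_self]
      exact map_zero (actOn A x))
    rwa [act_sub, act_smul, act_mul, ← smul_act, ← sub_act] at this
  exact smul_right_injective F hc (h2.trans h1.symm)

end Local

/-! ### Rank one operators and reduction to scalar forms -/

section Concrete

open InnerProductSpace InnerProductCModule

variable {H : Type*} [NormedAddCommGroup H] [InnerProductSpace ℂ H]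

theorem isCompactOperator_rankOne (ξ η : H) : IsCompactOperator (rankOne ℂ ξ η) := by
  rw [rankOne_def']
  exact (isCompactOperator_of_locallyCompactSpace_rng
    (ContinuousLinearMap.toSpanSingleton ℂ ξ)).comp_clm (innerSL ℂ η)

variable [CompleteSpace H] (A : NonUnitalStarSubalgebra ℂ (H →L[ℂ] H))

/-- The rank one operator `ζ ↦ ⟪η, ζ⟫ ξ` as an element of an algebra containing the compacts. -/
noncomputable def rankOneMem (hA : ∀ K : H →L[ℂ] H, IsCompactOperator K → K ∈ A) (ξ η : H) : A :=
  ⟨rankOne ℂ ξ η, hA _ (isCompactOperator_rankOne ξ η)⟩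

variable {A} (hA : ∀ K : H →L[ℂ] H, IsCompactOperator K → K ∈ A)

theorem star_rankOneMem (ξ η : H) : star (rankOneMem A hA ξ η) = rankOneMem A hA η ξ :=
  Subtype.ext (by
    change star (rankOne ℂ ξ η : H →L[ℂ] H) = rankOne ℂ η ξ
    rw [ContinuousLinearMap.star_eq_adjoint, adjoint_rankOne])

theorem rankOneMem_mul_mul (ξ η ξ' η' : H) (a : A) :
    rankOneMem A hA ξ η * a * rankOneMem A hA ξ' η' =
      inner ℂ η ((a : H →L[ℂ] H) ξ') • rankOneMem A hA ξ η' := by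
  apply Subtype.ext
  ext z
  change (rankOne ℂ ξ η : H →L[ℂ] H) ((a : H →L[ℂ] H) ((rankOne ℂ ξ' η' : H →L[ℂ] H) z)) =
    inner ℂ η ((a : H →L[ℂ] H) ξ') • (rankOne ℂ ξ η' : H →L[ℂ] H) z
  simp [smul_smul, mul_comm]

theorem rankOneMem_mul (ξ η ξ' η' : H) :
    rankOneMem A hA ξ η * rankOneMem A hA ξ' η' = inner ℂ η ξ' • rankOneMem A hA ξ η' := by
  apply Subtype.ext
  ext z
  change (rankOne ℂ ξ η : H →L[ℂ] H) ((rankOne ℂ ξ' η' : H →L[ℂ] H) z) =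
    inner ℂ η ξ' • (rankOne ℂ ξ η' : H →L[ℂ] H) z
  simp [smul_smul, mul_comm]

/-- The linear functional `a ↦ ⟪ζ, a ζ⟫` on an operator algebra. -/
noncomputable def vectorFunctional (A : NonUnitalStarSubalgebra ℂ (H →L[ℂ] H)) (ζ : H) :
    A →ₗ[ℂ] ℂ where
  toFun a := inner ℂ ζ ((a : H →L[ℂ] H) ζ)
  map_add' a b := by simp
  map_smul' c a := by simp

theorem vectorFunctional_star (ζ : H) (a : A) :
    star (vectorFunctional A ζ a) = vectorFunctional A ζ (star a) := by
  change star (inner ℂ ζ ((a : H →L[ℂ] H) ζ)) = inner ℂ ζ ((star (a : H →L[ℂ] H)) ζ)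
  rw [ContinuousLinearMap.star_eq_adjoint, ContinuousLinearMap.adjoint_inner_right]
  exact inner_conj_symm _ _

theorem vectorFunctional_nonneg (ζ : H) {a : A} (ha : 0 ≤ a) : 0 ≤ vectorFunctional A ζ a := by
  have h : (0 : H →L[ℂ] H) ≤ (a : H →L[ℂ] H) := ha
  exact ((ContinuousLinearMap.nonneg_iff_isPositive _).1 h).inner_nonneg_right ζ

theorem rankOneMem_mul_mul_self (ζ : H) (a : A) :
    rankOneMem A hA ζ ζ * a * rankOneMem A hA ζ ζ =
      vectorFunctional A ζ a • rankOneMem A hA ζ ζ :=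
  rankOneMem_mul_mul hA ζ ζ ζ ζ a

/-- Transports every matrix coefficient of a to the single vector ζ. -/
theorem vectorFunctional_rankOneMem_mul_mul {ζ : H} (hζ : ‖ζ‖ = 1) (ξ η : H) (a : A) :
    vectorFunctional A ζ (rankOneMem A hA ζ ξ * a * rankOneMem A hA η ζ) =
      inner ℂ ξ ((a : H →L[ℂ] H) η) := by
  have h : vectorFunctional A ζ (rankOneMem A hA ζ ζ) = 1 := by
    change inner ℂ ζ ((rankOne ℂ ζ ζ : H →L[ℂ] H) ζ) = 1
    simp [hζ]
  rw [rankOneMem_mul_mul, map_smul, h, smul_eq_mul, mul_one]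

variable [IsClosed (A : Set (H →L[ℂ] H))]
  {E F : Type*} [AddCommGroup E] [Module ℂ E] [SMul Aᵐᵒᵖ E] [InnerProductCModule A E]
  [AddCommGroup F] [Module ℂ F] [SMul Aᵐᵒᵖ F] [InnerProductCModule A F]

theorem IsLocalMap.map_act_rankOneMem {T : E →ₗ[ℂ] F} (hT : IsLocalMap A T) (ξ η : H) (x : E) :
    T (x <• rankOneMem A hA ξ η) = T x <• rankOneMem A hA ξ η := by
  have hne : ∀ ξ η : H, inner ℂ η ξ ≠ 0 →
      T (x <• rankOneMem A hA ξ η) = T x <• rankOneMem A hA ξ η := fun ξ η h =>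
    hT.map_act_of_mul_self h (rankOneMem_mul hA ξ η ξ η) x
  by_cases h : inner ℂ η ξ = 0
  · rcases eq_or_ne ξ 0 with rfl | hξ
    · have h0 : rankOneMem A hA 0 η = 0 := Subtype.ext (by simp [rankOneMem])
      have hE : x <• (0 : A) = 0 := map_zero (actOn A x)
      have hF : T x <• (0 : A) = 0 := map_zero (actOn A (T x))
      rw [h0, hE, hF, map_zero]
    -- For ξ ⊥ η the operator squares to zero; both terms of this difference square to ‖ξ‖² times
    -- themselves.
    · have h1 : rankOneMem A hA ξ η = rankOneMem A hA ξ (η + ξ) - rankOneMem A hA ξ ξ :=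
        Subtype.ext (by simp [rankOneMem])
      rw [h1, act_sub, act_sub, map_sub, hne ξ ξ (inner_self_ne_zero.2 hξ),
        hne ξ (η + ξ) (by rw [inner_add_left, h, zero_add]; exact inner_self_ne_zero.2 hξ)]
  · exact hne ξ η h

/-- A local orthogonality preserving map scales the inner product by a nonnegative constant. -/
theorem IsOrthogonalityPreserving.exists_nonneg_inner_eq_smul [Nontrivial H]
    (hA : ∀ K : H →L[ℂ] H, IsCompactOperator K → K ∈ A) {T : E →ₗ[ℂ] F}
    (horth : IsOrthogonalityPreserving A T) (hT : IsLocalMap A T) :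
    ∃ γ : ℝ, 0 ≤ γ ∧ ∀ x y : E, inner A (T x) (T y) = γ • inner A x y := by
  obtain ⟨ζ, hζ⟩ := exists_norm_eq H zero_le_one
  set e := rankOneMem A hA ζ ζ with he
  have hestar : star e = e := star_rankOneMem hA ζ ζ
  have heu : ∀ ξ, rankOneMem A hA ξ ζ * e = rankOneMem A hA ξ ζ := fun ξ => by
    rw [he, rankOneMem_mul, inner_self_eq_norm_sq_to_K, hζ]
    simp
  -- This is Ee.
  let V : Submodule ℂ E := LinearMap.eqLocus (actRight E e) LinearMap.id
  have hV : ∀ x : V, (x : E) <• e = x := fun x => x.2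
  have hinner : ∀ x y : V, inner A (x : E) (y : E) =
      vectorFunctional A ζ (inner A (x : E) (y : E)) • e := fun x y => by
    conv_lhs => rw [← hV x, ← hV y, inner_act_right, inner_act_left, hestar]
    exact rankOneMem_mul_mul_self hA ζ _
  obtain ⟨γ, hγ0, hγ⟩ := exists_nonneg_eq_mul_of_orthogonality (V := V)
    (fun x => vectorFunctional A ζ ∘ₗ innerLeft A (x : E) ∘ₗ V.subtype)
    (fun x => vectorFunctional A ζ ∘ₗ innerLeft A (T x) ∘ₗ T ∘ₗ V.subtype)
    (fun x y => (vectorFunctional_star ζ _).trans (congrArg _ (star_inner _ _)))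
    (fun x y => (vectorFunctional_star ζ _).trans (congrArg _ (star_inner _ _)))
    (fun x => vectorFunctional_nonneg ζ (inner_self_nonneg _))
    (fun x => vectorFunctional_nonneg ζ (inner_self_nonneg _))
    (fun x h => by
      change vectorFunctional A ζ (inner A (x : E) (x : E)) = 0 at h
      have h1 := hinner x x
      rw [h, zero_smul] at h1
      exact Subtype.ext ((inner_self_eq_zero _).1 h1))
    (fun x y h => by
      change vectorFunctional A ζ (inner A (x : E) (y : E)) = 0 at h
      have h1 := hinner x y
      rw [h, zero_smul] at h1
      change vectorFunctional A ζ (inner A (T x) (T y)) = 0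
      rw [horth _ _ h1, map_zero])
  refine ⟨γ, hγ0, fun x y => Subtype.ext (ContinuousLinearMap.ext fun η =>
    ext_inner_left ℂ fun ξ => ?_)⟩
  have hmem : ∀ (z : E) (θ : H), z <• rankOneMem A hA θ ζ ∈ V := fun z θ => by
    change (z <• rankOneMem A hA θ ζ) <• e = z <• rankOneMem A hA θ ζ
    rw [← act_mul, heu]
  have key : vectorFunctional A ζ
        (inner A (T (x <• rankOneMem A hA ξ ζ)) (T (y <• rankOneMem A hA η ζ))) =
      γ * vectorFunctional A ζ
        (inner A (x <• rankOneMem A hA ξ ζ) (y <• rankOneMem A hA η ζ)) :=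
    hγ ⟨_, hmem x ξ⟩ ⟨_, hmem y η⟩
  rw [hT.map_act_rankOneMem, hT.map_act_rankOneMem, inner_act_right, inner_act_left,
    inner_act_right, inner_act_left, star_rankOneMem, vectorFunctional_rankOneMem_mul_mul hA hζ,
    vectorFunctional_rankOneMem_mul_mul hA hζ] at key
  rw [key]
  change _ = inner ℂ ξ (γ • ((inner A x y : A) : H →L[ℂ] H) η)
  rw [← Complex.coe_smul, _root_.inner_smul_right]

end Concrete

theorem theorem4p6 {H : Type*} [NormedAddCommGroup H] [InnerProductSpace ℂ H] [CompleteSpace H]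
    (A : NonUnitalStarSubalgebra ℂ (H →L[ℂ] H)) [IsClosed (A : Set (H →L[ℂ] H))]
    (hA : ∀ K : H →L[ℂ] H, IsCompactOperator K → K ∈ A)
    {E F : Type*} [AddCommGroup E] [Module ℂ E] [SMul Aᵐᵒᵖ E] [InnerProductCModule A E]
    [AddCommGroup F] [Module ℂ F] [SMul Aᵐᵒᵖ F] [InnerProductCModule A F]
    (T : E →ₗ[ℂ] F) (hlocal : IsLocalMap A T) (hT : T ≠ 0)
    (horth : IsOrthogonalityPreserving A T) :
    (∃ γ : ℝ, 0 < γ ∧ ∀ x y : E, inner A (T x) (T y) = γ • inner A x y) ∧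
    (∀ x y : E, InnerProductCModule.modulus A x = InnerProductCModule.modulus A y ↔
      InnerProductCModule.modulus A (T x) = InnerProductCModule.modulus A (T y)) ∧
    (∀ x y : E, InnerProductCModule.modulus A x ≤ InnerProductCModule.modulus A y ↔
      InnerProductCModule.modulus A (T x) ≤ InnerProductCModule.modulus A (T y)) := by
  have hne : ∃ x, T x ≠ 0 := by
    by_contra! h
    exact hT (LinearMap.ext h)
  obtain ⟨x₀, hx₀⟩ := hne
  -- If H = 0 then A = 0, so every inner product vanishes and F = 0.
  have hH : Nontrivial H := by
    by_contra h
    rw [not_nontrivial_iff_subsingleton] at h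
    exact hx₀ ((InnerProductCModule.inner_self_eq_zero (A := A) _).1
      (Subtype.ext (ContinuousLinearMap.ext fun _ => Subsingleton.elim _ _)))
  obtain ⟨γ, hγ0, hγ⟩ := IsOrthogonalityPreserving.exists_nonneg_inner_eq_smul hA horth hlocal
  have hpos : 0 < γ := by
    refine lt_of_le_of_ne hγ0 fun h => hx₀ ?_
    rw [← InnerProductCModule.inner_self_eq_zero (A := A), hγ, ← h, zero_smul]
  have hmod : ∀ x : E, InnerProductCModule.modulus A (T x) = √γ • InnerProductCModule.modulus A x := fun x =>
    InnerProductCModule.modulus_eq_smul_of_inner_self hγ0 (hγ x x)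
  have hsqrt : 0 < √γ := Real.sqrt_pos.2 hpos
  refine ⟨⟨γ, hpos, hγ⟩, fun x y => ?_, fun x y => ?_⟩
  · rw [hmod, hmod]
    exact (smul_right_injective A hsqrt.ne').eq_iff.symm
  · rw [hmod, hmod]
    exact (smul_le_smul_iff_of_pos_left hsqrt).symm
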